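/- A *loop* is a set $Q$ with a multiplication with neutral element $1$ such that all translations $L_x(y)=xy$ and $R_x(y)=yx$ are bijections of $Q$; put $x\backslash y=L_x^{-1}(y)$ and $y/x=R_x^{-1}(y)$. A *normal subloop* of $Q$ is the kernel $\{x: f(x)=1\}$ of a homomorphism $f$ from $Q$ to a loop. A normal subloop $A$ determines the congruence $x\equiv_A y\iff x/y\in A$ and the factor loop $Q/A$. For normal subloops $A,B$ of $Q$, the *commutator* $[A,B]_Q$ is the smallest normal subloop $D$ of $Q$ such that for every loop term $t(x,y_1,\dots,y_n)$ (built from variables and $1$ by means of $\cdot,/,\backslash$), all $a\equiv_A b$ in $Q$ and all $u_i\equiv_B v_i$ in $Q$: if $t(a,u_1,\dots,u_n)\equiv_D t(a,v_1,\dots,v_n)$, then $t(b,u_1,\dots,u_n)\equiv_D t(b,v_1,\dots,v_n)$. A normal subloop $A$ is *central in $Q$* if $[A,Q]_Q=1$. The loop $Q$ is *centrally nilpotent* if there is a series $1=A_0\le A_1\le\dots\le A_n=Q$ of normal subloops of $Q$ such that $A_{i+1}/A_i$ is central in $Q/A_i$ for every $0\le i<n$. Let $A=(A,+)$ be an abelian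 group and $F$ a loop. A *loop cocycle* is a triple $\Gamma=(\varphi,\psi,\theta)$ of mappings $\varphi,\psi:F\times F\to\mathrm{Aut}(A)$ and $\theta:F\times F\to A$ such that $\varphi_{y,1}=\mathrm{id}=\psi_{1,y}$ and $\theta_{1,y}=0=\theta_{y,1}$ for every $y\in F$. The *abelian extension* of $A$ by $F$ over $\Gamma$ is the loop on $A\times F$ with multiplication $$(a,x)(b,y)=(\varphi_{x,y}(a)+\psi_{x,y}(b)+\theta_{x,y},\,xy);$$ it is a *central extension* if $\varphi_{x,y}=\psi_{x,y}=\mathrm{id}$ for all $x,y\in F$. *Iterated central extensions* are defined inductively: a loop is an iterated central extension if it is an abelian group, or if it is isomorphic to a central extension of an abelian group by an iterated central extension. **Corollary.** A loop is centrally nilpotent if and only if it is an iterated central extension. -/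

import Mathlib

namespace LoopTheory

universe u

/-- A loop: a multiplication with neutral element `1` all of whose translations are bijective.
The inverses of the translations are the division operations, `ldiv x y` being `L_x⁻¹ y` and
`y / x` being `R_x⁻¹ y`; they are determined by the multiplication. -/
class Loop (Q : Type u) extends MulOneClass Q, Div Q where
  /-- left division -/
  ldiv : Q → Q → Q
  mul_ldiv (x y : Q) : x * ldiv x y = y
  ldiv_mul (x y : Q) : ldiv x (x * y) = y
  div_mul (x y : Q) : y / x * x = y
  mul_div (x y : Q) : y * x / x = y

section basics

variable {Q L : Type u} [Loop Q] [Loop L]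

theorem div_eq_iff (x y z : Q) : x / y = z ↔ x = z * y :=
  ⟨fun h => by rw [← h, Loop.div_mul], fun h => by rw [h, Loop.mul_div]⟩

theorem ldiv_eq_iff (x y z : Q) : Loop.ldiv x y = z ↔ y = x * z :=
  ⟨fun h => by rw [← h, Loop.mul_ldiv], fun h => by rw [h, Loop.ldiv_mul]⟩

theorem map_rdiv (f : Q →* L) (x y : Q) : f (x / y) = f x / f y := by
  rw [eq_comm, div_eq_iff, ← map_mul, Loop.div_mul]

theorem map_ldiv (f : Q →* L) (x y : Q) : f (Loop.ldiv x y) = Loop.ldiv (f x) (f y) := by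
  rw [eq_comm, ldiv_eq_iff, ← map_mul, Loop.mul_ldiv]

theorem div_eq_one_iff (x y : Q) : x / y = 1 ↔ x = y := by
  rw [div_eq_iff, one_mul]

instance {ι : Type u} {F : ι → Type u} [∀ i, Loop (F i)] : Loop (∀ i, F i) where
  ldiv x y := fun i => Loop.ldiv (x i) (y i)
  mul_ldiv x y := funext fun i => Loop.mul_ldiv (x i) (y i)
  ldiv_mul x y := funext fun i => Loop.ldiv_mul (x i) (y i)
  div_mul x y := funext fun i => Loop.div_mul (x i) (y i)
  mul_div x y := funext fun i => Loop.mul_div (x i) (y i)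

end basics

/-- A normal subloop of `Q`: a subset of `Q` (necessarily a subloop) which is the kernel of a
homomorphism from `Q` to a loop. -/
@[ext]
structure NormalSubloop (Q : Type u) [Loop Q] where
  /-- the underlying set -/
  carrier : Set Q
  exists_ker : ∃ (L : Type u) (_ : Loop L) (f : Q →* L), carrier = {x | f x = 1}

namespace NormalSubloop

variable {Q : Type u} [Loop Q]

instance : LE (NormalSubloop Q) := ⟨fun A B => A.carrier ⊆ B.carrier⟩

/-- The trivial normal subloop `1`. -/
instance : Bot (NormalSubloop Q) := ⟨⟨{1}, Q, inferInstance, MonoidHom.id Q, rfl⟩⟩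

/-- The normal subloop `Q` of `Q`. -/
instance : Top (NormalSubloop Q) := ⟨⟨Set.univ, Q, inferInstance, 1, by simp⟩⟩

/-- The congruence of `Q` given by the normal subloop `A`. -/
def Rel (A : NormalSubloop Q) (x y : Q) : Prop := x / y ∈ A.carrier

theorem exists_hom (A : NormalSubloop Q) :
    ∃ (L : Type u) (_ : Loop L) (f : Q →* L),
      A.carrier = {x | f x = 1} ∧ ∀ x y, A.Rel x y ↔ f x = f y := by
  obtain ⟨L, _, f, h⟩ := A.exists_ker
  refine ⟨L, _, f, h, fun x y => ?_⟩
  rw [Rel, h, Set.mem_ofPred_eq, map_rdiv, div_eq_one_iff]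

/-- The congruence of a normal subloop as a setoid. -/
def setoid (A : NormalSubloop Q) : Setoid Q where
  r := A.Rel
  iseqv := by
    obtain ⟨L, _, f, -, h⟩ := A.exists_hom
    exact ⟨fun x => (h x x).2 rfl, fun {x y} k => (h y x).2 ((h x y).1 k).symm,
      fun {x y z} k l => (h x z).2 (((h x y).1 k).trans ((h y z).1 l))⟩

theorem rel_mul (A : NormalSubloop Q) {x x' y y' : Q} (hx : A.Rel x x') (hy : A.Rel y y') :
    A.Rel (x * y) (x' * y') := by
  obtain ⟨L, _, f, -, h⟩ := A.exists_hom
  rw [h] at *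
  rw [map_mul, map_mul, hx, hy]

theorem rel_div (A : NormalSubloop Q) {x x' y y' : Q} (hx : A.Rel x x') (hy : A.Rel y y') :
    A.Rel (x / y) (x' / y') := by
  obtain ⟨L, _, f, -, h⟩ := A.exists_hom
  rw [h] at *
  rw [map_rdiv, map_rdiv, hx, hy]

theorem rel_ldiv (A : NormalSubloop Q) {x x' y y' : Q} (hx : A.Rel x x') (hy : A.Rel y y') :
    A.Rel (Loop.ldiv x y) (Loop.ldiv x' y') := by
  obtain ⟨L, _, f, -, h⟩ := A.exists_hom
  rw [h] at *
  rw [map_ldiv, map_ldiv, hx, hy]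

/-- The factor loop `Q/A`. -/
def Factor (A : NormalSubloop Q) : Type u := Quotient A.setoid

/-- The class of an element in the factor loop. -/
def toFactor (A : NormalSubloop Q) (x : Q) : A.Factor := Quotient.mk A.setoid x

instance (A : NormalSubloop Q) : Loop A.Factor where
  mul := Quotient.map₂ (· * ·) fun _ _ h _ _ k => A.rel_mul h k
  one := A.toFactor 1
  div := Quotient.map₂ (· / ·) fun _ _ h _ _ k => A.rel_div h k
  ldiv := Quotient.map₂ Loop.ldiv fun _ _ h _ _ k => A.rel_ldiv h k
  one_mul := by rintro ⟨x⟩; exact congrArg A.toFactor (one_mul x)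
  mul_one := by rintro ⟨x⟩; exact congrArg A.toFactor (mul_one x)
  mul_ldiv := by rintro ⟨x⟩ ⟨y⟩; exact congrArg A.toFactor (Loop.mul_ldiv x y)
  ldiv_mul := by rintro ⟨x⟩ ⟨y⟩; exact congrArg A.toFactor (Loop.ldiv_mul x y)
  div_mul := by rintro ⟨x⟩ ⟨y⟩; exact congrArg A.toFactor (Loop.div_mul x y)
  mul_div := by rintro ⟨x⟩ ⟨y⟩; exact congrArg A.toFactor (Loop.mul_div x y)

/-- The natural projection `Q → Q/A`. -/
def proj (A : NormalSubloop Q) : Q →* A.Factor where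
  toFun := A.toFactor
  map_one' := rfl
  map_mul' _ _ := rfl

theorem proj_eq_iff (A : NormalSubloop Q) (x y : Q) : A.proj x = A.proj y ↔ A.Rel x y :=
  Quotient.eq (r := A.setoid)

theorem proj_eq_one_iff (A : NormalSubloop Q) (x : Q) : A.proj x = 1 ↔ x ∈ A.carrier := by
  rw [← map_one A.proj, proj_eq_iff, Rel, (div_eq_iff x 1 x).2 (mul_one x).symm]

/-- For `A ≤ B`, the natural homomorphism `Q/A → Q/B`. -/
def factorMap {A B : NormalSubloop Q} (h : A ≤ B) : A.Factor →* B.Factor where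
  toFun := Quotient.map id fun _ _ k => h k
  map_one' := rfl
  map_mul' := by rintro ⟨x⟩ ⟨y⟩; rfl

/-- For `A ≤ B`, the normal subloop `B/A` of `Q/A`. -/
def quotient {A B : NormalSubloop Q} (h : A ≤ B) : NormalSubloop A.Factor where
  carrier := A.proj '' B.carrier
  exists_ker := by
    refine ⟨B.Factor, inferInstance, factorMap h, ?_⟩
    ext ⟨x⟩
    constructor
    · rintro ⟨y, hy, e⟩
      have e' : A.proj y = A.proj x := e
      change factorMap h (A.proj x) = 1
      rw [← e']
      exact (B.proj_eq_one_iff y).2 hy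
    · intro hx
      exact ⟨x, (B.proj_eq_one_iff x).1 hx, rfl⟩

/-- The intersection of a set of normal subloops (which is `Q` for the empty set). -/
instance : InfSet (NormalSubloop Q) where
  sInf S :=
    { carrier := {x | ∀ A ∈ S, x ∈ A.carrier}
      exists_ker := by
        refine ⟨∀ A : S, A.1.Factor, inferInstance,
          { toFun := fun x A => A.1.proj x, map_one' := rfl, map_mul' := fun _ _ => rfl }, ?_⟩
        ext x
        constructor
        · intro h
          exact funext fun A => (A.1.proj_eq_one_iff x).2 (h A.1 A.2)
        · intro h A hA
          exact (A.proj_eq_one_iff x).1 (congrFun h ⟨A, hA⟩) }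

end NormalSubloop

/-- Loop terms with variables in `X`. -/
inductive LoopTerm (X : Type) : Type
  | var : X → LoopTerm X
  | one : LoopTerm X
  | mul : LoopTerm X → LoopTerm X → LoopTerm X
  | rdiv : LoopTerm X → LoopTerm X → LoopTerm X
  | ldiv : LoopTerm X → LoopTerm X → LoopTerm X

/-- The value of a loop term in a loop under an assignment of the variables. -/
def LoopTerm.eval {X : Type} {Q : Type u} [Loop Q] (e : X → Q) : LoopTerm X → Q
  | .var x => e x
  | .one => 1
  | .mul s t => s.eval e * t.eval e
  | .rdiv s t => s.eval e / t.eval e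
  | .ldiv s t => Loop.ldiv (s.eval e) (t.eval e)

namespace NormalSubloop

variable {Q : Type u} [Loop Q]

/-- The term condition `C(A, B; D)` of commutator theory, for the congruences given by `A`, `B`,
`D`: for all terms `t(x, y₁, …, yₙ)`, all `a`, `b` congruent modulo `A` and all `uᵢ`, `vᵢ`
congruent modulo `B`, if `t(a, u)`, `t(a, v)` are congruent modulo `D`, so are `t(b, u)`,
`t(b, v)`. -/
def Centralizes (A B D : NormalSubloop Q) : Prop :=
  ∀ (n : ℕ) (t : LoopTerm (Fin (n + 1))) (a b : Q) (u v : Fin n → Q),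
    A.Rel a b → (∀ i, B.Rel (u i) (v i)) →
    D.Rel (t.eval (Fin.cons a u)) (t.eval (Fin.cons a v)) →
    D.Rel (t.eval (Fin.cons b u)) (t.eval (Fin.cons b v))

/-- The commutator `[A, B]_Q`: the smallest normal subloop `D` of `Q` such that `A` centralizes
`B` modulo `D`. -/
def commutator (A B : NormalSubloop Q) : NormalSubloop Q :=
  sInf {D | Centralizes A B D}

/-- The infimum in the definition of the commutator is attained. -/
theorem centralizes_commutator (A B : NormalSubloop Q) : Centralizes A B (commutator A B) :=
  fun n t a b u v hab huv h D hD => hD n t a b u v hab huv (h D hD)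

/-- `A` is central in `Q` if `[A, Q]_Q = 1`. -/
def IsCentral (A : NormalSubloop Q) : Prop := commutator A ⊤ = ⊥

end NormalSubloop

/-- `Q` is centrally nilpotent: there is a series `1 = A₀ ≤ A₁ ≤ ⋯ ≤ Aₙ = Q` of normal subloops
of `Q` such that each `Aᵢ₊₁/Aᵢ` is central in `Q/Aᵢ`. -/
def IsCentrallyNilpotent (Q : Type u) [Loop Q] : Prop :=
  ∃ (n : ℕ) (A : ℕ → NormalSubloop Q), A 0 = ⊥ ∧ A n = ⊤ ∧
    ∀ i < n, ∃ h : A i ≤ A (i + 1), (NormalSubloop.quotient h).IsCentral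

/-- A loop cocycle `(φ, ψ, θ)` for the abelian group `A` and the loop `F`. -/
structure LoopCocycle (A F : Type u) [AddCommGroup A] [Loop F] where
  φ : F → F → A ≃+ A
  ψ : F → F → A ≃+ A
  θ : F → F → A
  φ_one (y : F) : φ y 1 = AddEquiv.refl A
  ψ_one (y : F) : ψ 1 y = AddEquiv.refl A
  θ_one_left (y : F) : θ 1 y = 0
  θ_one_right (y : F) : θ y 1 = 0

/-- The underlying set `A × F` of the abelian extension of `A` by `F` over a loop cocycle. -/
@[ext]
structure AbelianExtension {A F : Type u} [AddCommGroup A] [Loop F] (Γ : LoopCocycle A F) where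
  fst : A
  snd : F

/-- The loop operations of the abelian extension:
`(a, x) (b, y) = (φ_{x,y}(a) + ψ_{x,y}(b) + θ_{x,y}, xy)`, with neutral element `(0, 1)`. -/
instance {A F : Type u} [AddCommGroup A] [Loop F] (Γ : LoopCocycle A F) :
    Loop (AbelianExtension Γ) where
  mul p q := ⟨Γ.φ p.snd q.snd p.fst + Γ.ψ p.snd q.snd q.fst + Γ.θ p.snd q.snd, p.snd * q.snd⟩
  one := ⟨0, 1⟩
  div p q := ⟨(Γ.φ (p.snd / q.snd) q.snd).symm
    (p.fst - Γ.ψ (p.snd / q.snd) q.snd q.fst - Γ.θ (p.snd / q.snd) q.snd), p.snd / q.snd⟩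
  ldiv p q := ⟨(Γ.ψ p.snd (Loop.ldiv p.snd q.snd)).symm
    (q.fst - Γ.φ p.snd (Loop.ldiv p.snd q.snd) p.fst - Γ.θ p.snd (Loop.ldiv p.snd q.snd)),
    Loop.ldiv p.snd q.snd⟩
  one_mul p := by
    refine AbelianExtension.ext ?_ (one_mul p.snd)
    change Γ.φ 1 p.snd 0 + Γ.ψ 1 p.snd p.fst + Γ.θ 1 p.snd = p.fst
    simp [Γ.ψ_one, Γ.θ_one_left]
  mul_one p := by
    refine AbelianExtension.ext ?_ (mul_one p.snd)
    change Γ.φ p.snd 1 p.fst + Γ.ψ p.snd 1 0 + Γ.θ p.snd 1 = p.fst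
    simp [Γ.φ_one, Γ.θ_one_right]
  mul_ldiv p q := by
    refine AbelianExtension.ext ?_ (Loop.mul_ldiv p.snd q.snd)
    change Γ.φ p.snd (Loop.ldiv p.snd q.snd) p.fst +
      Γ.ψ p.snd (Loop.ldiv p.snd q.snd) ((Γ.ψ p.snd (Loop.ldiv p.snd q.snd)).symm _) + _ = _
    rw [AddEquiv.apply_symm_apply]
    abel
  ldiv_mul p q := by
    refine AbelianExtension.ext ?_ (Loop.ldiv_mul p.snd q.snd)
    change (Γ.ψ p.snd (Loop.ldiv p.snd (p.snd * q.snd))).symm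
      (Γ.φ p.snd q.snd p.fst + Γ.ψ p.snd q.snd q.fst + Γ.θ p.snd q.snd -
        Γ.φ p.snd (Loop.ldiv p.snd (p.snd * q.snd)) p.fst -
        Γ.θ p.snd (Loop.ldiv p.snd (p.snd * q.snd))) = q.fst
    rw [Loop.ldiv_mul, AddEquiv.symm_apply_eq]
    abel
  div_mul q p := by
    refine AbelianExtension.ext ?_ (Loop.div_mul q.snd p.snd)
    change Γ.φ (p.snd / q.snd) q.snd ((Γ.φ (p.snd / q.snd) q.snd).symm _) +
      Γ.ψ (p.snd / q.snd) q.snd q.fst + Γ.θ (p.snd / q.snd) q.snd = _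
    rw [AddEquiv.apply_symm_apply]
    abel
  mul_div q p := by
    refine AbelianExtension.ext ?_ (Loop.mul_div q.snd p.snd)
    change (Γ.φ (p.snd * q.snd / q.snd) q.snd).symm
      (Γ.φ p.snd q.snd p.fst + Γ.ψ p.snd q.snd q.fst + Γ.θ p.snd q.snd -
        Γ.ψ (p.snd * q.snd / q.snd) q.snd q.fst - Γ.θ (p.snd * q.snd / q.snd) q.snd) = p.fst
    rw [Loop.mul_div, AddEquiv.symm_apply_eq]
    abel

/-- The abelian extension over the loop cocycle `Γ` is a central extension: `φ = ψ = 1`. -/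
def LoopCocycle.IsCentral {A F : Type u} [AddCommGroup A] [Loop F] (Γ : LoopCocycle A F) : Prop :=
  ∀ x y, Γ.φ x y = AddEquiv.refl A ∧ Γ.ψ x y = AddEquiv.refl A

/-- The loop `Q` is an abelian group. -/
def IsAbelianGroup (Q : Type u) [Loop Q] : Prop :=
  (∀ x y z : Q, x * y * z = x * (y * z)) ∧ ∀ x y : Q, x * y = y * x

/-- Iterated central extensions: abelian groups, and loops that are (up to isomorphism) a central
extension of an abelian group by an iterated central extension. -/
inductive IsIteratedCentralExtension : (Q : Type u) → [Loop Q] → Prop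
  | of_isAbelianGroup (Q : Type u) [Loop Q] (h : IsAbelianGroup Q) : IsIteratedCentralExtension Q
  | of_extension (Q A F : Type u) [Loop Q] [AddCommGroup A] [Loop F] (Γ : LoopCocycle A F)
      (hΓ : Γ.IsCentral) (hF : IsIteratedCentralExtension F) (e : Q ≃* AbelianExtension Γ) :
      IsIteratedCentralExtension Q

end LoopTheory

namespace LoopTheory

universe u

/-! ### Calculus of central elements. -/

section centralElements

variable {Q : Type u} [Loop Q]

/-! The term condition `[A, Q]_Q = 1` says exactly that every element of `A` commutes and associates
with all of `Q` (`isCentral_iff_isMulCentral`). Central nilpotency is thus about homomorphisms with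
central kernel, and, up to isomorphism, a surjection `Q → F` with central kernel is the same as a
central extension by `F`: a transversal yields the cocycle (`exists_mulEquiv_abelianExtension`), and
conversely all pairs `(a, 1)` are central.

Both implications then add one central layer at a time. Given a series, each `Q/Aᵢ → Q/Aᵢ₊₁` has
central kernel, so one climbs from the trivial loop `Q/Aₙ` to `Q`. Given an extension `Q → F`, a
central series of `F` is pulled back to `Q` and `1` is put below it (`IsCentrallyNilpotent.of_hom`).
-/

theorem div_one (x : Q) : x / 1 = x :=
  (div_eq_iff x 1 x).2 (mul_one x).symm

/-- Central factors can be pulled out of all three loop operations; these rules drive the induction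
on terms. -/
theorem IsMulCentral.mul_mul_mul_comm {d : Q} (hd : IsMulCentral d) {c : Q} (hc : IsMulCentral c)
    (s t : Q) : c * s * (d * t) = c * d * (s * t) := by
  rw [← hc.left_assoc, ← hd.left_comm, hc.left_assoc]

theorem IsMulCentral.div_mul_div_comm {c d : Q} (hcd : IsMulCentral (c / d)) (hd : IsMulCentral d)
    (s t : Q) : c * s / (d * t) = c / d * (s / t) := by
  rw [div_eq_iff, IsMulCentral.mul_mul_mul_comm hd hcd, Loop.div_mul, Loop.div_mul]

theorem IsMulCentral.ldiv_mul_ldiv_comm {c d : Q} (hc : IsMulCentral c)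
    (hcd : IsMulCentral (Loop.ldiv c d)) (s t : Q) :
    Loop.ldiv (c * s) (d * t) = Loop.ldiv c d * Loop.ldiv s t := by
  rw [ldiv_eq_iff, IsMulCentral.mul_mul_mul_comm hcd hc, Loop.mul_ldiv, Loop.mul_ldiv]

end centralElements

/-! ### Commutator centrality versus the centre of a loop. -/

namespace NormalSubloop

variable {Q L : Type u} [Loop Q] [Loop L]

theorem one_mem (A : NormalSubloop Q) : (1 : Q) ∈ A.carrier :=
  (A.proj_eq_one_iff 1).1 (map_one _)

theorem mul_mem (A : NormalSubloop Q) {x y : Q} (hx : x ∈ A.carrier) (hy : y ∈ A.carrier) :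
    x * y ∈ A.carrier := by
  rw [← proj_eq_one_iff] at *
  rw [map_mul, hx, hy, mul_one]

theorem div_mem (A : NormalSubloop Q) {x y : Q} (hx : x ∈ A.carrier) (hy : y ∈ A.carrier) :
    x / y ∈ A.carrier := by
  rw [← proj_eq_one_iff] at *
  rw [map_rdiv, hx, hy, div_one]

theorem ldiv_mem (A : NormalSubloop Q) {x y : Q} (hx : x ∈ A.carrier) (hy : y ∈ A.carrier) :
    Loop.ldiv x y ∈ A.carrier := by
  rw [← proj_eq_one_iff] at *
  rw [map_ldiv, hx, hy, ldiv_eq_iff, mul_one]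

theorem rel_refl (A : NormalSubloop Q) (x : Q) : A.Rel x x :=
  (A.proj_eq_iff x x).1 rfl

theorem bot_rel_iff (x y : Q) : (⊥ : NormalSubloop Q).Rel x y ↔ x = y :=
  div_eq_one_iff x y

theorem bot_le (A : NormalSubloop Q) : ⊥ ≤ A := by
  rintro x rfl
  exact A.one_mem

theorem proj_surjective (A : NormalSubloop Q) : Function.Surjective A.proj :=
  Quotient.mk_surjective

/-- The kernel of a homomorphism of loops. -/
def ker (f : Q →* L) : NormalSubloop Q := ⟨{x | f x = 1}, L, inferInstance, f, rfl⟩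

/-- The preimage of a normal subloop under a homomorphism. -/
def comap (f : Q →* L) (A : NormalSubloop L) : NormalSubloop Q where
  carrier := f ⁻¹' A.carrier
  exists_ker := ⟨A.Factor, inferInstance, A.proj.comp f,
    Set.ext fun x => (A.proj_eq_one_iff (f x)).symm⟩

theorem comap_rel_iff (f : Q →* L) (A : NormalSubloop L) (x y : Q) :
    (comap f A).Rel x y ↔ A.Rel (f x) (f y) := by
  rw [Rel, Rel, ← map_rdiv]
  rfl

theorem isCentral_iff_centralizes (A : NormalSubloop Q) : A.IsCentral ↔ Centralizes A ⊤ ⊥ := by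
  constructor
  · intro h
    have := centralizes_commutator A ⊤
    rwa [show commutator A ⊤ = ⊥ from h] at this
  · intro h
    refine NormalSubloop.ext (Set.Subset.antisymm (fun x hx => hx ⊥ h) ?_)
    exact bot_le _

/-- A term identity of the form `t(1, u) = t(1, 1)` extends from `1` to all elements of `A`. -/
theorem Centralizes.eval_eq {A : NormalSubloop Q} (h : Centralizes A ⊤ ⊥) {n : ℕ}
    (t : LoopTerm (Fin (n + 1))) {a : Q} (ha : a ∈ A.carrier) (u : Fin n → Q)
    (hu : t.eval (Fin.cons 1 u) = t.eval (Fin.cons (1 : Q) fun _ => 1)) :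
    t.eval (Fin.cons a u) = t.eval (Fin.cons a fun _ => 1) := by
  rw [← bot_rel_iff] at *
  refine h n t 1 a u _ ?_ (fun _ => Set.mem_univ _) hu
  exact A.div_mem A.one_mem ha

/-- Each law is encoded as a term, the quotient of its two sides. At `a = 1` this is `1` for all
values of the other variables, so for general `a` it is still independent of them; setting them to
`1` gives `a / a = 1`. -/
theorem Centralizes.isMulCentral {A : NormalSubloop Q} (h : Centralizes A ⊤ ⊥) {a : Q}
    (ha : a ∈ A.carrier) : IsMulCentral a where
  comm x := by
    have : a * x / (x * a) = a * 1 / (1 * a) :=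
      h.eval_eq (n := 1) (.rdiv (.mul (.var 0) (.var 1)) (.mul (.var 1) (.var 0))) ha ![x]
        (by simp [LoopTerm.eval, (div_eq_one_iff _ _).2])
    rwa [mul_one, one_mul, (div_eq_one_iff a a).2 rfl, div_eq_one_iff] at this
  left_assoc x y := by
    have : a * (x * y) / (a * x * y) = a * (1 * 1) / (a * 1 * 1) :=
      h.eval_eq (n := 2) (.rdiv (.mul (.var 0) (.mul (.var 1) (.var 2)))
        (.mul (.mul (.var 0) (.var 1)) (.var 2))) ha ![x, y]
        (by simp [LoopTerm.eval, (div_eq_one_iff _ _).2])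
    rwa [mul_one, mul_one, mul_one, (div_eq_one_iff a a).2 rfl, div_eq_one_iff] at this
  right_assoc x y := by
    have : x * y * a / (x * (y * a)) = 1 * 1 * a / (1 * (1 * a)) :=
      h.eval_eq (n := 2) (.rdiv (.mul (.mul (.var 1) (.var 2)) (.var 0))
        (.mul (.var 1) (.mul (.var 2) (.var 0)))) ha ![x, y]
        (by simp [LoopTerm.eval, (div_eq_one_iff _ _).2])
    rwa [one_mul, one_mul, one_mul, (div_eq_one_iff a a).2 rfl, div_eq_one_iff] at this

/-- If `A` consists of central elements, then moving the first variable of a term within a class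
of `A` multiplies the value by an element of `A` that does not depend on the other variables. -/
theorem exists_eval_cons_eq_mul {A : NormalSubloop Q} (hA : ∀ a ∈ A.carrier, IsMulCentral a)
    {n : ℕ} (t : LoopTerm (Fin (n + 1))) {a b : Q} (hab : A.Rel b a) :
    ∃ c ∈ A.carrier, ∀ u : Fin n → Q, t.eval (Fin.cons b u) = c * t.eval (Fin.cons a u) := by
  induction t with
  | var i =>
    refine Fin.cases ⟨b / a, hab, fun u => ?_⟩ (fun j => ⟨1, A.one_mem, fun u => ?_⟩) i
    · simp [LoopTerm.eval, Loop.div_mul]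
    · simp [LoopTerm.eval]
  | one => exact ⟨1, A.one_mem, fun u => (one_mul _).symm⟩
  | mul s t hs ht =>
    obtain ⟨c, hc, hs⟩ := hs
    obtain ⟨d, hd, ht⟩ := ht
    refine ⟨c * d, A.mul_mem hc hd, fun u => ?_⟩
    rw [LoopTerm.eval, hs, ht, IsMulCentral.mul_mul_mul_comm (hA d hd) (hA c hc), LoopTerm.eval]
  | rdiv s t hs ht =>
    obtain ⟨c, hc, hs⟩ := hs
    obtain ⟨d, hd, ht⟩ := ht
    have hcd := A.div_mem hc hd
    refine ⟨c / d, hcd, fun u => ?_⟩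
    rw [LoopTerm.eval, hs, ht, IsMulCentral.div_mul_div_comm (hA _ hcd) (hA d hd), LoopTerm.eval]
  | ldiv s t hs ht =>
    obtain ⟨c, hc, hs⟩ := hs
    obtain ⟨d, hd, ht⟩ := ht
    have hcd := A.ldiv_mem hc hd
    refine ⟨Loop.ldiv c d, hcd, fun u => ?_⟩
    rw [LoopTerm.eval, hs, ht, IsMulCentral.ldiv_mul_ldiv_comm (hA c hc) (hA _ hcd), LoopTerm.eval]

theorem isCentral_iff_isMulCentral (A : NormalSubloop Q) :
    A.IsCentral ↔ ∀ a ∈ A.carrier, IsMulCentral a := by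
  rw [isCentral_iff_centralizes]
  refine ⟨fun h a ha => h.isMulCentral ha, fun hA n t a b u v hab _ h => ?_⟩
  -- The same factor `c` serves for `u` and `v`, so equality at `a` carries over to `b`.
  obtain ⟨c, -, hc⟩ := exists_eval_cons_eq_mul hA t (A.setoid.symm hab)
  rw [bot_rel_iff] at *
  rw [hc, hc, h]

/-- Congruences in `Q` replace equations in `Q/A`, a form that pulls back along homomorphisms. -/
theorem isCentral_quotient_iff {A B : NormalSubloop Q} (h : A ≤ B) :
    (quotient h).IsCentral ↔ ∀ a ∈ B.carrier, ∀ x y, A.Rel (a * x) (x * a) ∧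
      A.Rel (a * (x * y)) (a * x * y) ∧ A.Rel (x * y * a) (x * (y * a)) := by
  simp only [isCentral_iff_isMulCentral, ← proj_eq_iff, map_mul]
  constructor
  · intro H a ha x y
    have ha := H _ ⟨a, ha, rfl⟩
    exact ⟨ha.comm _, ha.left_assoc _ _, ha.right_assoc _ _⟩
  · rintro H _ ⟨a, ha, rfl⟩
    refine ⟨A.proj_surjective.forall.2 fun x => (H a ha x 1).1,
      A.proj_surjective.forall₂.2 fun x y => (H a ha x y).2.1,
      A.proj_surjective.forall₂.2 fun x y => (H a ha x y).2.2⟩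

end NormalSubloop

/-! ### Central kernels and central extensions. -/

section extensions

variable {Q F : Type u} [Loop Q] [Loop F]

/-- The abelian group structure, written additively, of a normal subloop of central elements. -/
abbrev NormalSubloop.addCommGroup (A : NormalSubloop Q) (hA : ∀ a ∈ A.carrier, IsMulCentral a) :
    AddCommGroup A.carrier :=
  letI : Add A.carrier := ⟨fun a b => ⟨a.1 * b.1, A.mul_mem a.2 b.2⟩⟩
  letI : Zero A.carrier := ⟨⟨1, A.one_mem⟩⟩
  letI : Neg A.carrier := ⟨fun a => ⟨1 / a.1, A.div_mem A.one_mem a.2⟩⟩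
  { AddGroup.ofLeftAxioms
      (fun a b c => Subtype.ext ((hA a.1 a.2).left_assoc b.1 c.1).symm)
      (fun a => Subtype.ext (one_mul a.1))
      (fun a => Subtype.ext (Loop.div_mul a.1 1)) with
    add_comm := fun a b => Subtype.ext ((hA a.1 a.2).comm b.1) }

/-- A loop with a homomorphism onto `F` whose kernel consists of central elements is a central
extension of the kernel by `F`. -/
theorem exists_mulEquiv_abelianExtension (f : Q →* F) (hf : Function.Surjective f)
    (hker : ∀ a, f a = 1 → IsMulCentral a) :
    ∃ (A : Type u) (_ : AddCommGroup A) (Γ : LoopCocycle A F),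
      Γ.IsCentral ∧ Nonempty (Q ≃* AbelianExtension Γ) := by
  classical
  -- A transversal with `s 1 = 1`, which makes `θ` below vanish when an argument is `1`.
  obtain ⟨s, hs, hs1⟩ : ∃ s : F → Q, (∀ x, f (s x) = x) ∧ s 1 = 1 := by
    obtain ⟨s, hs⟩ := hf.hasRightInverse
    refine ⟨Function.update s 1 1, fun x => ?_, Function.update_self ..⟩
    by_cases hx : x = 1
    · rw [hx, Function.update_self, map_one]
    · rw [Function.update_of_ne hx, hs]
  let A := NormalSubloop.ker f
  let _ : AddCommGroup A.carrier := A.addCommGroup hker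
  let Γ : LoopCocycle A.carrier F :=
    { φ := fun _ _ => AddEquiv.refl _
      ψ := fun _ _ => AddEquiv.refl _
      -- `θ` measures the failure of `s` to be multiplicative.
      θ := fun x y => ⟨s x * s y / s (x * y), by
        change f _ = 1
        rw [map_rdiv, map_mul, hs, hs, hs, div_eq_one_iff]⟩
      φ_one := fun _ => rfl
      ψ_one := fun _ => rfl
      θ_one_left := fun y => Subtype.ext (by
        change s 1 * s y / s (1 * y) = 1
        rw [hs1, one_mul, one_mul, div_eq_one_iff])
      θ_one_right := fun y => Subtype.ext (by
        change s y * s 1 / s (y * 1) = 1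
        rw [hs1, mul_one, mul_one, div_eq_one_iff]) }
  -- Every `q` is uniquely `a * s x` with `a` in the kernel, namely with `x = f q`.
  refine ⟨A.carrier, inferInstance, Γ, fun _ _ => ⟨rfl, rfl⟩, ⟨MulEquiv.symm
    { toFun := fun p => p.fst.1 * s p.snd
      invFun := fun q => ⟨⟨q / s (f q), ?_⟩, f q⟩
      left_inv := ?_
      right_inv := fun q => Loop.div_mul _ _
      map_mul' := ?_ }⟩⟩
  · change f _ = 1
    rw [map_rdiv, hs, div_eq_one_iff]
  · rintro ⟨⟨a, ha⟩, x⟩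
    have hx : f (a * s x) = x := by rw [map_mul, show f a = 1 from ha, hs, one_mul]
    refine AbelianExtension.ext (Subtype.ext ?_) hx
    change a * s x / s (f (a * s x)) = a
    rw [hx, Loop.mul_div]
  · rintro ⟨⟨a, ha⟩, x⟩ ⟨⟨b, hb⟩, y⟩
    change a * b * (s x * s y / s (x * y)) * s (x * y) = a * s x * (b * s y)
    rw [IsMulCentral.mul_mul_mul_comm (hker b hb) (hker a ha),
      ← (hker _ (A.mul_mem ha hb)).left_assoc, Loop.div_mul]

theorem IsIteratedCentralExtension.of_surjective (hF : IsIteratedCentralExtension F) (f : Q →* F)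
    (hf : Function.Surjective f) (hker : ∀ a, f a = 1 → IsMulCentral a) :
    IsIteratedCentralExtension Q := by
  obtain ⟨A, _, Γ, hΓ, ⟨e⟩⟩ := exists_mulEquiv_abelianExtension f hf hker
  exact .of_extension Q A F Γ hΓ hF e

/-! ### From central series to iterated extensions. -/

theorem IsCentrallyNilpotent.isIteratedCentralExtension (h : IsCentrallyNilpotent Q) :
    IsIteratedCentralExtension Q := by
  obtain ⟨n, A, h0, hn, h⟩ := h
  have key : IsIteratedCentralExtension (A 0).Factor := by
    refine Nat.decreasingInduction' (P := fun i => IsIteratedCentralExtension (A i).Factor)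
      (fun i hi _ hF => ?_) n.zero_le ?_
    · obtain ⟨hle, hc⟩ := h i hi
      refine hF.of_surjective (NormalSubloop.factorMap hle) ?_ ?_
      · rintro ⟨x⟩
        exact ⟨(A i).proj x, rfl⟩
      · rw [NormalSubloop.isCentral_iff_isMulCentral] at hc
        intro a ha
        obtain ⟨x, rfl⟩ := (A i).proj_surjective a
        exact hc _ ⟨x, ((A (i + 1)).proj_eq_one_iff x).1 ha, rfl⟩
    · have : Subsingleton (A n).Factor := ⟨(A n).proj_surjective.forall₂.2 fun x y => by
        rw [NormalSubloop.proj_eq_iff, hn]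
        exact Set.mem_univ _⟩
      exact .of_isAbelianGroup _ ⟨fun _ _ _ => Subsingleton.elim _ _,
        fun _ _ => Subsingleton.elim _ _⟩
  -- `Q → Q/1` counts as one more extension, with trivial kernel; this avoids transport along an
  -- isomorphism.
  refine key.of_surjective (A 0).proj (A 0).proj_surjective fun a ha => ?_
  rw [NormalSubloop.proj_eq_one_iff, h0] at ha
  obtain rfl : a = 1 := ha
  exact ⟨fun x => (one_mul x).trans (mul_one x).symm, by simp, by simp⟩

/-! ### From iterated extensions to central series. -/

theorem IsAbelianGroup.isCentrallyNilpotent (h : IsAbelianGroup Q) : IsCentrallyNilpotent Q := by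
  refine ⟨1, fun i => if i = 0 then ⊥ else ⊤, rfl, rfl, fun i hi => ?_⟩
  obtain rfl : i = 0 := by omega
  refine ⟨NormalSubloop.bot_le _, ?_⟩
  rw [NormalSubloop.isCentral_quotient_iff]
  intro a _ x y
  rw [h.2 a x, h.1 x y a, ← h.1 a x y, h.2 a x]
  exact ⟨NormalSubloop.rel_refl _ _, NormalSubloop.rel_refl _ _, NormalSubloop.rel_refl _ _⟩

theorem IsCentrallyNilpotent.of_hom (hF : IsCentrallyNilpotent F) (f : Q →* F)
    (hker : ∀ a, f a = 1 → IsMulCentral a) : IsCentrallyNilpotent Q := by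
  obtain ⟨n, B, h0, hn, hB⟩ := hF
  refine ⟨n + 1, fun i => Nat.casesOn i ⊥ fun j => .comap f (B j), rfl, ?_, ?_⟩
  · change NormalSubloop.comap f (B n) = ⊤
    rw [hn]
    rfl
  · rintro (_ | i) hi
    -- Since `B 0 = ⊥`, the lowest layer is the kernel of `f`.
    · have hle : ⊥ ≤ NormalSubloop.comap f (B 0) := NormalSubloop.bot_le _
      refine ⟨hle, (NormalSubloop.isCentral_quotient_iff hle).2 fun a ha x y => ?_⟩
      replace ha : f a ∈ (B 0).carrier := ha
      rw [h0] at ha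
      have ha := hker a ha
      simp only [NormalSubloop.bot_rel_iff]
      exact ⟨ha.comm x, ha.left_assoc x y, ha.right_assoc x y⟩
    · obtain ⟨hle, hc⟩ := hB i (by omega)
      have hle' : NormalSubloop.comap f (B i) ≤ NormalSubloop.comap f (B (i + 1)) :=
        fun x hx => hle hx
      rw [NormalSubloop.isCentral_quotient_iff] at hc
      refine ⟨hle', (NormalSubloop.isCentral_quotient_iff hle').2 fun a ha x y => ?_⟩
      simpa only [NormalSubloop.comap_rel_iff, map_mul] using hc (f a) ha (f x) (f y)

/-- The projection of an abelian extension onto its second factor. -/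
def AbelianExtension.sndHom {A : Type u} [AddCommGroup A] (Γ : LoopCocycle A F) :
    AbelianExtension Γ →* F where
  toFun := AbelianExtension.snd
  map_one' := rfl
  map_mul' _ _ := rfl

theorem LoopCocycle.IsCentral.mul_def {A : Type u} [AddCommGroup A] {Γ : LoopCocycle A F}
    (hΓ : Γ.IsCentral) (p q : AbelianExtension Γ) :
    p * q = ⟨p.fst + q.fst + Γ.θ p.snd q.snd, p.snd * q.snd⟩ := by
  change AbelianExtension.mk (Γ.φ p.snd q.snd p.fst + Γ.ψ p.snd q.snd q.fst + _) _ = _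
  rw [(hΓ _ _).1, (hΓ _ _).2]
  rfl

/-- The normalization of `θ` kills every cocycle term having `1` as an argument, so the two sides of
each law agree. -/
theorem LoopCocycle.IsCentral.isMulCentral {A : Type u} [AddCommGroup A] {Γ : LoopCocycle A F}
    (hΓ : Γ.IsCentral) (a : A) : IsMulCentral (⟨a, 1⟩ : AbelianExtension Γ) where
  comm p := by
    simp only [Commute, SemiconjBy, hΓ.mul_def, Γ.θ_one_left, Γ.θ_one_right, one_mul, mul_one,
      add_comm a]
  left_assoc p q := by
    simp only [hΓ.mul_def, Γ.θ_one_left, one_mul, add_zero, add_assoc]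
  right_assoc p q := by
    simp only [hΓ.mul_def, Γ.θ_one_right, mul_one, add_zero, AbelianExtension.mk.injEq, and_true]
    abel

theorem IsIteratedCentralExtension.isCentrallyNilpotent (h : IsIteratedCentralExtension Q) :
    IsCentrallyNilpotent Q := by
  induction h with
  | of_isAbelianGroup Q h => exact h.isCentrallyNilpotent
  | of_extension Q A F Γ hΓ _ e ih =>
    refine ih.of_hom ((AbelianExtension.sndHom Γ).comp e.toMonoidHom) fun a ha => ?_
    have hc : IsMulCentral (e a) := by
      -- By `ha` the second component of `e a` is `1`.
      have := hΓ.isMulCentral (e a).fst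
      rwa [show (1 : F) = (e a).snd from ha.symm] at this
    constructor
    · exact fun x => e.injective (by simpa only [map_mul] using (hc.comm (e x)).eq)
    · exact fun x y => e.injective (by simpa only [map_mul] using hc.left_assoc (e x) (e y))
    · exact fun x y => e.injective (by simpa only [map_mul] using hc.right_assoc (e x) (e y))

end extensions

end LoopTheory

theorem corollary4p2 {Q : Type*} [LoopTheory.Loop Q] :
    LoopTheory.IsCentrallyNilpotent Q ↔ LoopTheory.IsIteratedCentralExtension Q :=
  ⟨LoopTheory.IsCentrallyNilpotent.isIteratedCentralExtension,
    LoopTheory.IsIteratedCentralExtension.isCentrallyNilpotent⟩
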